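/- Let $C_n=\frac{1}{n+1}\binom{2n}{n}$ and $c(x)=\sum_{n\ge 0}C_nx^n$. For power series $g,f\in\mathbb{Z}[[x]]$ let $(g,f)$ denote the infinite matrix, with rows and columns indexed by $0,1,2,\ldots$, whose $k$-th column has generating function $g(x)f(x)^k$. An infinite lower-triangular integer matrix $E$ with ones on the diagonal is called an eigentriangle of an infinite lower-triangular integer matrix $M$ with ones on the diagonal if, for all $n,k\ge 0$, $(ME)(n,k)=E(n+1,k)$ when $k\le n$ and $(ME)(n,k)=0$ when $k>n$. The $n$-th Takeuchi number $t_n$ ($n\ge 0$) is the number of times the "else" clause is invoked when $\tau(n,0,n+1)$ is evaluated (call by value, without memorization) by the recursive program $$\tau(x,y,z)=\text{if } x\le y \text{ then } y \text{ else } \tau(\tau(x-1,y,z),\tau(y-1,z,x),\tau(z-1,x,y)),\qquad x,y,z\in\mathbb{Z}.$$ Theorem. The Catalan triangle $A=(c(x),xc(x))$ has entries $A(n,k)=\binom{2n-k}{n-k}\frac{k+1}{n+1}$ for $0\le k\le n$. It has exactly one eigentriangle $E$, and the lower-triangular matrix $(1,x)-(xc(x),xc(x))$ is invertible with two-sided inverse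 $E$ (among infinite lower-triangular matrices). One has $E(n,k)=\tilde E(n-k,k)$ for $k\le n$ and $E(n,k)=0$ for $k>n$, where $\tilde E(0,j)=1$ and $$\tilde E(n,j)=\sum_{k=0}^{n-1}\binom{2(n-1)+j-k}{n-1-k}\frac{k+j+1}{n+j}\,\tilde E(k,j)\qquad(n\ge 1,\ j\ge 0).$$ For every $n\ge 0$ the evaluation defining $t_n$ terminates. The sequence $(t_n)$ is the image under $E$ of the sequence with $k$-th term $\sum_{j=0}^{k-1}C_{j+1}$, that is, $t_n=\sum_{k=0}^{n}E(n,k)\sum_{j=0}^{k-1}C_{j+1}$. Explicitly, $$t_n=\sum_{k=0}^{n}\tilde E(n-k,k)\sum_{j=0}^{k-1}C_{j+1}\qquad(n\ge 0).$$ -/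

import Mathlib

open PowerSeries

/-- The generating function `c(x) = ∑ Cₙ xⁿ` of the Catalan numbers, with integer coefficients. -/
noncomputable def catalanGF : PowerSeries ℤ :=
  PowerSeries.mk fun n => (catalan n : ℤ)

/-- The infinite integer matrix `(g, f)` whose `k`-th column has generating function
`g(x) f(x)^k`. -/
noncomputable def riordanMatrix (g f : PowerSeries ℤ) : Matrix ℕ ℕ ℤ :=
  fun n k => PowerSeries.coeff n (g * f ^ k)

/-- The Catalan triangle `(c(x), x c(x))`. -/
noncomputable def catalanTriangle : Matrix ℕ ℕ ℤ :=
  riordanMatrix catalanGF (X * catalanGF)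

/-- An infinite matrix is lower triangular if its entries above the diagonal vanish. -/
def IsLowerTriangular (M : Matrix ℕ ℕ ℤ) : Prop :=
  ∀ n k, n < k → M n k = 0

/-- The product of infinite matrices. It is used only when the left factor is lower triangular,
so that each of the sums has finitely many nonzero terms. -/
noncomputable def infMul (M N : Matrix ℕ ℕ ℤ) : Matrix ℕ ℕ ℤ :=
  fun n k => ∑ᶠ j, M n j * N j k

/-- The image of a sequence (a column vector) under an infinite matrix, used only for
lower triangular matrices. -/
noncomputable def infMulVec (M : Matrix ℕ ℕ ℤ) (a : ℕ → ℤ) : ℕ → ℤ :=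
  fun n => ∑ᶠ k, M n k * a k

/-- `N` is the two-sided inverse of `M` among the infinite lower triangular matrices. -/
def IsTriangularInverse (M N : Matrix ℕ ℕ ℤ) : Prop :=
  IsLowerTriangular M ∧ IsLowerTriangular N ∧ infMul M N = 1 ∧ infMul N M = 1

/-- `E` is an eigentriangle of `M`: it is lower triangular with ones on the diagonal, and the
product `M E` is the lower triangular matrix obtained from `E` by deleting the top row and then
the diagonal of ones that has moved above the main diagonal. -/
def IsEigentriangle (M E : Matrix ℕ ℕ ℤ) : Prop :=
  IsLowerTriangular E ∧ (∀ n, E n n = 1) ∧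
    ∀ n k, infMul M E n k = if k ≤ n then E (n + 1) k else 0

/-- `TakeuchiEval x y z v m`: the evaluation (call by value, without memorization) of the
Takeuchi function
`t(x,y,z) = if x ≤ y then y else t(t(x-1,y,z), t(y-1,z,x), t(z-1,x,y))`
terminates with value `v`, and the "else" clause is invoked exactly `m` times in its course. -/
inductive TakeuchiEval : ℤ → ℤ → ℤ → ℤ → ℕ → Prop
  | base (x y z : ℤ) (h : x ≤ y) : TakeuchiEval x y z y 0
  | step (x y z a b c v : ℤ) (p q r s : ℕ) (h : y < x)
      (ha : TakeuchiEval (x - 1) y z a p)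
      (hb : TakeuchiEval (y - 1) z x b q)
      (hc : TakeuchiEval (z - 1) x y c r)
      (hv : TakeuchiEval a b c v s) :
      TakeuchiEval x y z v (1 + p + q + r + s)

/-- `N` is the `n`-th Takeuchi number: the evaluation of `t(n, 0, n+1)` terminates and invokes
the "else" clause `N` times. -/
def IsTakeuchiNumber (n N : ℕ) : Prop :=
  ∃ v : ℤ, TakeuchiEval (n : ℤ) 0 ((n : ℤ) + 1) v N

/-- The numbers `Ẽ(n, j)` given by `Ẽ(0, j) = 1` and, for `n ≥ 1`,
`Ẽ(n, j) = ∑_{k=0}^{n-1} binom(2(n-1)+j-k, n-1-k) (k+j+1)/(n+j) Ẽ(k, j)`. -/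
def eTilde : ℕ → ℕ → ℚ
  | 0, _ => 1
  | n + 1, j => ∑ k : Fin (n + 1),
      ((2 * n + j - (k : ℕ)).choose (n - (k : ℕ)) : ℚ) *
        ((((k : ℕ) + j + 1 : ℕ) : ℚ) / ((n + 1 + j : ℕ) : ℚ)) * eTilde (k : ℕ) j
  termination_by n => n
  decreasing_by exact k.isLt

/-- The partial sums `∑_{j<n} C_{j+1}` of the Catalan numbers. -/
def catalanPartialSum (n : ℕ) : ℕ :=
  ∑ j ∈ Finset.range n, catalan (j + 1)

/-! Row `n + 1` of `(xc, xc)` is row `n` of `A`, so the eigentriangle equation says `(1 - (xc, xc))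
E = 1`. It determines `E` row by row, and `E a` is the unique solution of `s (n+1) = a (n+1) + ∑ k ≤
n, A(n,k) s k` with `s 0 = a 0`. It remains to see that the Takeuchi numbers solve this for `a` the
Catalan partial sums.

Let `T(n,m)` be the cost of `t(m, 0, n+1)`. Tracing the program gives `T(n+1,m+1) = T(n+1,m) + 1 +
T(n,m+1)` for `0 < m < n`, with an extra `T(n,n)` when `m = 0 < n`, and without the last term when
`m = n` (`takeuchiEval_count`). This is a ballot-type recurrence. Pairing its diagonals with
coefficients of powers of `c` and summing by parts (`sum_mul_ballot_succ`) moves from one diagonal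
to the next at the cost of one Catalan number. Iterating (`sum_takeuchiDiagonal`) expresses
`T(n+1,n+1)` through the `T(k,k)` with `k ≤ n`, with weights `A(n,k)` (`takeuchiCount_succ`). -/

/-! ### Powers of the Catalan generating function -/

/-- The coefficient of `x ^ p` in `c(x) ^ r`. -/
noncomputable def ballot (r p : ℕ) : ℤ :=
  PowerSeries.coeff p (catalanGF ^ r)

theorem catalanGF_eq : catalanGF = 1 + X * catalanGF ^ 2 := by
  have h := congrArg (PowerSeries.map (Nat.castRingHom ℤ))
    PowerSeries.catalanSeries_sq_mul_X_add_one
  have hc : PowerSeries.map (Nat.castRingHom ℤ) PowerSeries.catalanSeries = catalanGF := by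
    ext n
    simp [catalanGF]
  simp only [map_add, map_mul, map_pow, hc, PowerSeries.map_X, map_one] at h
  linear_combination -h

theorem ballot_zero_left (p : ℕ) : ballot 0 p = if p = 0 then 1 else 0 := by
  simp [ballot, PowerSeries.coeff_one]

theorem ballot_zero_right (r : ℕ) : ballot r 0 = 1 := by
  simp [ballot, catalanGF]

theorem ballot_one (p : ℕ) : ballot 1 p = catalan p := by
  simp [ballot, catalanGF]

theorem ballot_succ_succ (r p : ℕ) :
    ballot (r + 1) (p + 1) = ballot r (p + 1) + ballot (r + 2) p := by
  have h : catalanGF ^ (r + 1) = catalanGF ^ r + X * catalanGF ^ (r + 2) := by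
    linear_combination catalanGF ^ r * catalanGF_eq
  simp only [ballot]
  rw [h, map_add, PowerSeries.coeff_succ_X_mul]

/-- The two sides obey the same recurrence `ballot_succ_succ`, hence the double induction on `p` and
then `r`; denominators are cleared throughout. -/
theorem ballot_formula (p r : ℕ) :
    (ballot (r + 1) p : ℚ) * (p + r + 1) = (r + 1) * (2 * p + r).choose p := by
  induction p generalizing r with
  | zero => simp [ballot_zero_right]
  | succ p ihp =>
    have key : ∀ r : ℕ, ((2 * p + r + 2).choose (p + 1) : ℚ) * (p + 1) =
        (2 * p + r + 2) * (2 * p + r + 1).choose p := by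
      intro r
      have := Nat.add_one_mul_choose_eq (2 * p + r + 1) p
      exact_mod_cast this.symm
    have key2 : ∀ r : ℕ, ((2 * p + r + 2).choose (p + 1) : ℚ) * (p + r + 1) =
        (2 * p + r + 2) * (2 * p + r + 1).choose (p + 1) := by
      intro r
      have := Nat.choose_mul_succ_eq (2 * p + r + 1) (p + 1)
      have e : 2 * p + r + 1 + 1 - (p + 1) = p + r + 1 := by omega
      rw [e] at this
      push_cast [← @Nat.cast_inj ℚ] at this
      linarith
    induction r with
    | zero =>
      rw [ballot_succ_succ, ballot_zero_left, if_neg (by omega),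
        show 2 * (p + 1) + 0 = 2 * p + 0 + 2 by ring]
      have h := ihp 1
      have k := key 0
      have hp : (p : ℚ) + 1 ≠ 0 := by positivity
      apply mul_left_cancel₀ hp
      simp only [add_zero, zero_add, one_add_one_eq_two] at h k ⊢
      push_cast at h k ⊢
      linear_combination (p + 1 : ℚ) * h - k
    | succ r ihr =>
      rw [ballot_succ_succ]
      have h := ihp (r + 2)
      have k := key (r + 1)
      have k2 := key2 (r + 1)
      rw [show 2 * (p + 1) + r = 2 * p + (r + 1) + 1 by ring] at ihr
      rw [show 2 * p + (r + 2) = 2 * p + (r + 1) + 1 by ring,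
        show r + 2 + 1 = r + 1 + 2 by ring] at h
      rw [show 2 * (p + 1) + (r + 1) = 2 * p + (r + 1) + 2 by ring]
      push_cast at h k k2 ihr ⊢
      generalize ((2 * p + (r + 1) + 2).choose (p + 1) : ℚ) = c at *
      generalize ((2 * p + (r + 1) + 1).choose (p + 1) : ℚ) = d at *
      generalize ((2 * p + (r + 1) + 1).choose p : ℚ) = d' at *
      generalize (ballot (r + 1) (p + 1) : ℚ) = u at *
      generalize (ballot (r + 1 + 2) p : ℚ) = v at *
      -- Multiplying by `2p + r + 3` lets the absorption identities `k` and `k2` express both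
      -- smaller binomials through `c`.
      have hu : (2 * (p : ℚ) + r + 3) * u = (r + 1) * c := by
        have hp : (p : ℚ) + r + 2 ≠ 0 := by positivity
        apply mul_left_cancel₀ hp
        linear_combination (2 * (p : ℚ) + r + 3) * ihr - (r + 1) * k2
      have hp : 2 * (p : ℚ) + r + 3 ≠ 0 := by positivity
      apply mul_left_cancel₀ hp
      linear_combination (p + r + 3 : ℚ) * hu + (2 * (p : ℚ) + r + 3) * h - (r + 3) * k

/-- A convolution identity for powers of the Catalan series. -/
theorem sum_ballot (L r : ℕ) :
    ∑ s ∈ Finset.range (L + 1), ballot (s + r + 1) (L - s) = ballot (r + 2) L := by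
  induction L generalizing r with
  | zero => simp [ballot_zero_right]
  | succ L ih =>
    -- In series form: `∑ x^s c^(s+r+1) = c^(r+1) / (1 - xc) = c^(r+2)`. The induction peels off the
    -- term `s = 0`.
    rw [Finset.sum_range_succ', ballot_succ_succ, ← ih (r + 1)]
    simp only [Nat.add_sub_add_right, Nat.sub_zero, zero_add]
    rw [add_comm]
    congr 1
    refine Finset.sum_congr rfl fun s _ => ?_
    congr 1
    omega

/-- Summation by parts along one row of the ballot recurrence. -/
theorem sum_mul_ballot_succ (f g : ℕ → ℤ) (L : ℕ) (h0 : g 0 = f 0 + 1 + f 1)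
    (hs : ∀ s, g (s + 1) = g s + f (s + 2)) :
    ∑ s ∈ Finset.range (L + 2), f s * ballot (s + 1) (L + 1 - s) + catalan (L + 1) =
      ∑ s ∈ Finset.range (L + 1), g s * ballot (s + 1) (L - s) := by
  -- The ballot recurrence makes the weights differences, and `h2` does the same for `f`; the sums
  -- then differ by a reindexing (`h3`) and boundary terms.
  have h1 : ∀ s ∈ Finset.range L, g s * ballot (s + 1) (L - s) =
      g s * ballot (s + 2) (L - s) - g s * ballot (s + 3) (L - (s + 1)) := by
    intro s hs
    obtain ⟨q, rfl⟩ : ∃ q, L = s + q + 1 := ⟨L - s - 1, by have := Finset.mem_range.1 hs; omega⟩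
    have e1 : s + q + 1 - s = q + 1 := by omega
    have e2 : s + q + 1 - (s + 1) = q := by omega
    rw [e1, e2, ballot_succ_succ (s + 1) q]
    ring
  have h2 : ∀ s ∈ Finset.range L, f (s + 1 + 1) * ballot (s + 1 + 1 + 1) (L + 1 - (s + 1 + 1)) =
      g (s + 1) * ballot (s + 1 + 2) (L - (s + 1)) - g s * ballot (s + 3) (L - (s + 1)) := by
    intro s _
    rw [hs, Nat.add_sub_add_right]
    ring
  have h3 := Finset.sum_range_succ' (fun s => g s * ballot (s + 2) (L - s)) L
  rw [Finset.sum_range_succ] at h3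
  rw [Finset.sum_range_succ', Finset.sum_range_succ', Finset.sum_congr rfl h2,
    Finset.sum_range_succ, Finset.sum_congr rfl h1, Finset.sum_sub_distrib,
    Finset.sum_sub_distrib]
  have h4 : ballot 1 (L + 1) = ballot 2 L := by
    rw [ballot_succ_succ, ballot_zero_left]
    simp
  have h5 := ballot_one (L + 1)
  simp only [Nat.sub_self, ballot_zero_right, Nat.sub_zero, Nat.add_sub_cancel, zero_add,
    one_add_one_eq_two] at *
  rw [← h5, h4]
  linear_combination (-1 : ℤ) * h3 + (-ballot 2 L) * h0

/-! ### Lower triangular matrices -/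

theorem infMul_apply {M : Matrix ℕ ℕ ℤ} (hM : IsLowerTriangular M) (N : Matrix ℕ ℕ ℤ)
    {n m : ℕ} (h : n < m) (k : ℕ) :
    infMul M N n k = ∑ j ∈ Finset.range m, M n j * N j k := by
  refine finsum_eq_sum_of_support_subset _ fun j hj => ?_
  by_contra hj'
  have : m ≤ j := by simpa using hj'
  exact hj (by simp [hM n j (by omega)])

theorem infMulVec_apply {M : Matrix ℕ ℕ ℤ} (hM : IsLowerTriangular M) (a : ℕ → ℤ) (n : ℕ) :
    infMulVec M a n = ∑ j ∈ Finset.range (n + 1), M n j * a j := by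
  refine finsum_eq_sum_of_support_subset _ fun j hj => ?_
  by_contra hj'
  have : n + 1 ≤ j := by simpa using hj'
  exact hj (by simp [hM n j (by omega)])

/-- A right inverse of a lower triangular matrix is also a left inverse. -/
theorem infMul_eq_one_comm {M N : Matrix ℕ ℕ ℤ} (hM : IsLowerTriangular M)
    (hN : IsLowerTriangular N) (h : infMul M N = 1) : infMul N M = 1 := by
  -- Leading square truncation respects products with a lower triangular left factor, so the claim
  -- reduces to finite matrices, where one-sided inverses are two-sided.
  have trunc : ∀ {A B : Matrix ℕ ℕ ℤ} (_ : IsLowerTriangular A) (m : ℕ) (i k : Fin m),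
      infMul A B i k = (A.submatrix Fin.val Fin.val *
        B.submatrix Fin.val Fin.val : Matrix (Fin m) (Fin m) ℤ) i k := by
    intro A B hA m i k
    rw [infMul_apply hA B i.isLt, Matrix.mul_apply, Finset.sum_range]
    rfl
  ext n k
  have key : N.submatrix (Fin.val (n := max n k + 1)) Fin.val *
      M.submatrix Fin.val (Fin.val (n := max n k + 1)) = 1 := by
    rw [mul_eq_one_comm]
    ext i j
    rw [← trunc hM, h]
    simp [Matrix.one_apply, Fin.ext_iff]
  have := trunc (B := M) hN (max n k + 1) ⟨n, by omega⟩ ⟨k, by omega⟩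
  rw [key] at this
  simpa [Matrix.one_apply, Fin.ext_iff] using this

/-! ### The Catalan triangle and its eigentriangle. -/

theorem catalanTriangle_apply (n k : ℕ) :
    catalanTriangle n k = if k ≤ n then ballot (k + 1) (n - k) else 0 := by
  have : catalanGF * (X * catalanGF) ^ k = X ^ k * catalanGF ^ (k + 1) := by ring
  rw [catalanTriangle, riordanMatrix, this, PowerSeries.coeff_X_pow_mul', ballot]

theorem isLowerTriangular_catalanTriangle : IsLowerTriangular catalanTriangle := by
  intro n k h
  rw [catalanTriangle_apply, if_neg (by omega)]

theorem catalanTriangle_formula {n k : ℕ} (h : k ≤ n) : (catalanTriangle n k : ℚ) =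
    ((2 * n - k).choose (n - k) : ℚ) * (((k + 1 : ℕ) : ℚ) / ((n + 1 : ℕ) : ℚ)) := by
  obtain ⟨p, rfl⟩ := Nat.exists_eq_add_of_le h
  have e : 2 * (k + p) - k = 2 * p + k := by omega
  rw [catalanTriangle_apply, if_pos h, Nat.add_sub_cancel_left, e, mul_div_assoc',
    eq_div_iff (by positivity)]
  have := ballot_formula p k
  push_cast
  linear_combination this

theorem riordanMatrix_one_X : riordanMatrix 1 X = 1 := by
  ext n k
  simp [riordanMatrix, PowerSeries.coeff_X_pow, Matrix.one_apply]

theorem riordanMatrix_zero (k : ℕ) :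
    riordanMatrix (X * catalanGF) (X * catalanGF) 0 k = 0 := by
  simp [riordanMatrix]

theorem riordanMatrix_succ (n k : ℕ) :
    riordanMatrix (X * catalanGF) (X * catalanGF) (n + 1) k = catalanTriangle n k := by
  rw [riordanMatrix, mul_assoc, PowerSeries.coeff_succ_X_mul]
  rfl

/-- The entries of the eigentriangle of the Catalan triangle. -/
noncomputable def catalanEigentriangleEntry : ℕ → ℕ → ℤ
  | 0, k => if k = 0 then 1 else 0
  | n + 1, k =>
      if k ≤ n then ∑ j : Fin (n + 1), catalanTriangle n j * catalanEigentriangleEntry j k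
      else if k = n + 1 then 1 else 0
  termination_by n => n
  decreasing_by exact j.isLt

/-- The eigentriangle of the Catalan triangle. -/
noncomputable def catalanEigentriangle : Matrix ℕ ℕ ℤ :=
  fun n k => catalanEigentriangleEntry n k

theorem catalanEigentriangle_zero (k : ℕ) : catalanEigentriangle 0 k = if k = 0 then 1 else 0 := by
  rw [catalanEigentriangle, catalanEigentriangleEntry]

theorem catalanEigentriangle_succ_apply (n k : ℕ) : catalanEigentriangle (n + 1) k =
    if k ≤ n then ∑ j ∈ Finset.range (n + 1), catalanTriangle n j * catalanEigentriangle j k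
    else if k = n + 1 then 1 else 0 := by
  rw [catalanEigentriangle, catalanEigentriangleEntry, Finset.sum_range]
  rfl

theorem isLowerTriangular_catalanEigentriangle : IsLowerTriangular catalanEigentriangle := by
  intro n k h
  cases n with
  | zero => rw [catalanEigentriangle_zero, if_neg (by omega)]
  | succ n => rw [catalanEigentriangle_succ_apply, if_neg (by omega), if_neg (by omega)]

theorem catalanEigentriangle_diag (n : ℕ) : catalanEigentriangle n n = 1 := by
  cases n with
  | zero => rw [catalanEigentriangle_zero, if_pos rfl]
  | succ n => rw [catalanEigentriangle_succ_apply, if_neg (by omega), if_pos rfl]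

theorem catalanEigentriangle_succ {n k : ℕ} (h : k ≤ n) : catalanEigentriangle (n + 1) k =
    ∑ j ∈ Finset.range (n + 1), catalanTriangle n j * catalanEigentriangle j k := by
  rw [catalanEigentriangle_succ_apply, if_pos h]

theorem sum_catalanTriangle_mul (n k : ℕ) :
    ∑ j ∈ Finset.range (n + 1), catalanTriangle n j * catalanEigentriangle j k =
      if k ≤ n then catalanEigentriangle (n + 1) k else 0 := by
  split_ifs with h
  · exact (catalanEigentriangle_succ h).symm
  · refine Finset.sum_eq_zero fun j hj => ?_
    have := Finset.mem_range.1 hj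
    rw [isLowerTriangular_catalanEigentriangle j k (by omega), mul_zero]

theorem isEigentriangle_iff (E : Matrix ℕ ℕ ℤ) :
    IsEigentriangle catalanTriangle E ↔ E = catalanEigentriangle := by
  have happ := fun N : Matrix ℕ ℕ ℤ => fun n : ℕ =>
    infMul_apply isLowerTriangular_catalanTriangle N (Nat.lt_succ_self n)
  constructor
  · rintro ⟨hl, hd, he⟩
    ext n k
    induction n using Nat.strong_induction_on with
    | _ n ih =>
      rcases lt_trichotomy n k with h | rfl | h
      · rw [hl n k h, isLowerTriangular_catalanEigentriangle n k h]
      · rw [hd, catalanEigentriangle_diag]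
      · obtain ⟨m, rfl⟩ : ∃ m, n = m + 1 := ⟨n - 1, by omega⟩
        have h1 := he m k
        rw [if_pos (by omega), happ] at h1
        rw [← h1, catalanEigentriangle_succ (by omega)]
        exact Finset.sum_congr rfl fun j hj => by rw [ih j (Finset.mem_range.1 hj)]
  · rintro rfl
    refine ⟨isLowerTriangular_catalanEigentriangle, catalanEigentriangle_diag, fun n k => ?_⟩
    rw [happ]
    exact sum_catalanTriangle_mul n k

/-- Subtracting row `n` of `A E` from row `n + 1` of `E` cancels everything except the diagonal one.
-/
theorem isTriangularInverse_catalanEigentriangle :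
    IsTriangularInverse (riordanMatrix 1 X - riordanMatrix (X * catalanGF) (X * catalanGF))
      catalanEigentriangle := by
  have hL : IsLowerTriangular
      (riordanMatrix 1 X - riordanMatrix (X * catalanGF) (X * catalanGF)) := by
    intro n k h
    rw [Matrix.sub_apply, riordanMatrix_one_X, Matrix.one_apply_ne h.ne]
    cases n with
    | zero => rw [riordanMatrix_zero, sub_zero]
    | succ n => rw [riordanMatrix_succ, isLowerTriangular_catalanTriangle n k (by omega), sub_zero]
  have hE : infMul (riordanMatrix 1 X - riordanMatrix (X * catalanGF) (X * catalanGF))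
      catalanEigentriangle = 1 := by
    ext n k
    rw [infMul_apply hL _ (Nat.lt_succ_self n)]
    simp only [Matrix.sub_apply, riordanMatrix_one_X, sub_mul, Finset.sum_sub_distrib,
      Matrix.one_apply, ite_mul, one_mul, zero_mul, Finset.sum_ite_eq, Finset.mem_range,
      Nat.lt_succ_self, if_true]
    cases n with
    | zero =>
      simp [riordanMatrix_zero, catalanEigentriangle_zero, eq_comm]
    | succ n =>
      simp only [riordanMatrix_succ]
      rw [Finset.sum_range_succ, isLowerTriangular_catalanTriangle n (n + 1) (by omega), zero_mul,
        add_zero, sum_catalanTriangle_mul]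
      rcases lt_trichotomy (n + 1) k with h | rfl | h
      · rw [isLowerTriangular_catalanEigentriangle _ _ h, if_neg (by omega), if_neg (by omega),
          sub_zero]
      · rw [catalanEigentriangle_diag, if_neg (by omega), if_pos rfl, sub_zero]
      · rw [if_pos (by omega), if_neg (by omega), sub_self]
  exact ⟨hL, isLowerTriangular_catalanEigentriangle, hE,
    infMul_eq_one_comm hL isLowerTriangular_catalanEigentriangle hE⟩

/-- Column `k` vanishes above the diagonal, so shifting the summation index by `k` turns the row
recursion into that of `eTilde`. -/
theorem catalanEigentriangle_add (m k : ℕ) : (catalanEigentriangle (k + m) k : ℚ) = eTilde m k := by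
  induction m using Nat.strong_induction_on with
  | _ m ih =>
    cases m with
    | zero => rw [add_zero, catalanEigentriangle_diag, eTilde, Int.cast_one]
    | succ m =>
      rw [← add_assoc, catalanEigentriangle_succ (by omega), eTilde, add_assoc k m 1,
        Finset.sum_range_add, Finset.sum_eq_zero, zero_add, Finset.sum_range, Int.cast_sum]
      · refine Finset.sum_congr rfl fun i _ => ?_
        have hi : (i : ℕ) ≤ m := Nat.lt_succ_iff.1 i.isLt
        rw [Int.cast_mul, ih i i.isLt, catalanTriangle_formula (by omega)]
        have e1 : 2 * (k + m) - (k + i) = 2 * m + k - i := by omega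
        have e2 : k + m - (k + i) = m - i := by omega
        rw [e1, e2, add_comm k (i : ℕ), add_comm k m, add_right_comm m k 1]
      · intro j hj
        rw [isLowerTriangular_catalanEigentriangle j k (Finset.mem_range.1 hj), mul_zero]

theorem catalanEigentriangle_cast (n k : ℕ) :
    (catalanEigentriangle n k : ℚ) = if k ≤ n then eTilde (n - k) k else 0 := by
  split_ifs with h
  · obtain ⟨m, rfl⟩ := Nat.exists_eq_add_of_le h
    rw [catalanEigentriangle_add, Nat.add_sub_cancel_left]
  · rw [isLowerTriangular_catalanEigentriangle n k (by omega), Int.cast_zero]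

/-- The image of `a` under the eigentriangle solves `s = a + (x c(x), x c(x)) s`. -/
theorem infMulVec_catalanEigentriangle_succ (a : ℕ → ℤ) (n : ℕ) :
    infMulVec catalanEigentriangle a (n + 1) = a (n + 1) +
      ∑ k ∈ Finset.range (n + 1), catalanTriangle n k * infMulVec catalanEigentriangle a k := by
  have h : ∀ k ∈ Finset.range (n + 1), catalanTriangle n k * infMulVec catalanEigentriangle a k =
      ∑ j ∈ Finset.range (n + 1), catalanTriangle n k * catalanEigentriangle k j * a j := by
    intro k hk
    rw [infMulVec_apply isLowerTriangular_catalanEigentriangle, Finset.mul_sum]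
    simp only [mul_assoc]
    have hk' := Finset.mem_range.1 hk
    refine Finset.sum_subset (Finset.range_subset_range.2 (by omega)) fun j _ hj => ?_
    have := Finset.mem_range.not.1 hj
    rw [isLowerTriangular_catalanEigentriangle k j (by omega), zero_mul, mul_zero]
  rw [infMulVec_apply isLowerTriangular_catalanEigentriangle, Finset.sum_range_succ,
    catalanEigentriangle_diag, one_mul, add_comm, Finset.sum_congr rfl h, Finset.sum_comm]
  congr 1
  refine Finset.sum_congr rfl fun j hj => ?_
  rw [← Finset.sum_mul, sum_catalanTriangle_mul,
    if_pos (Nat.lt_succ_iff.1 (Finset.mem_range.1 hj))]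

theorem eq_infMulVec_catalanEigentriangle {a s : ℕ → ℤ} (h0 : s 0 = a 0)
    (h : ∀ n, s (n + 1) = a (n + 1) + ∑ k ∈ Finset.range (n + 1), catalanTriangle n k * s k)
    (n : ℕ) : s n = infMulVec catalanEigentriangle a n := by
  induction n using Nat.strong_induction_on with
  | _ n ih =>
    cases n with
    | zero =>
      rw [h0, infMulVec_apply isLowerTriangular_catalanEigentriangle]
      simp [catalanEigentriangle_diag]
    | succ n =>
      rw [h, infMulVec_catalanEigentriangle_succ]
      congr 1
      exact Finset.sum_congr rfl fun k hk => by rw [ih k (Finset.mem_range.1 hk)]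

/-! ### The Takeuchi recursion -/

/-- The evaluation of the Takeuchi function is deterministic. -/
theorem TakeuchiEval.unique {x y z v w : ℤ} {m n : ℕ} (h : TakeuchiEval x y z v m)
    (h' : TakeuchiEval x y z w n) : v = w ∧ m = n := by
  induction h generalizing w n with
  | base x y z hxy =>
    cases h' with
    | base => exact ⟨rfl, rfl⟩
    | step => omega
  | step x y z a b c v p q r s hxy _ _ _ _ iha ihb ihc ihv =>
    cases h' with
    | base => omega
    | step _ _ _ a' b' c' v' p' q' r' s' _ ha hb hc hv =>
      obtain ⟨rfl, rfl⟩ := iha ha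
      obtain ⟨rfl, rfl⟩ := ihb hb
      obtain ⟨rfl, rfl⟩ := ihc hc
      obtain ⟨rfl, rfl⟩ := ihv hv
      exact ⟨rfl, rfl⟩

/-- `takeuchiCount n m` is the number of invocations of the "else" clause in the evaluation of
`t(m, 0, n + 1)` for `m ≤ n`. -/
def takeuchiCount : ℕ → ℕ → ℕ
  | _, 0 => 0
  | 0, _ + 1 => 0
  | n + 1, m + 1 => takeuchiCount (n + 1) m + 1 +
      if m = n then 0 else takeuchiCount n (m + 1) + if m = 0 then takeuchiCount n n else 0

theorem takeuchiCount_zero (n : ℕ) : takeuchiCount n 0 = 0 := by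
  cases n <;> rw [takeuchiCount]

/-- The evaluation of `t(n + 1, m + 1, 0)` for `m ≤ n`, given the evaluations with smaller first
argument. -/
theorem takeuchiEval_desc {n : ℕ}
    (hU : ∀ m ≤ n, TakeuchiEval m 0 (n + 1) (if m = 0 then 0 else n + 1) (takeuchiCount n m))
    (hD : ∀ m, m + 1 ≤ n → TakeuchiEval n (m + 1) 0 n
      (if m + 1 = n then 0 else takeuchiCount (n - 1) (m + 1) +
        if m = 0 then takeuchiCount (n - 1) (n - 1) else 0))
    (m : ℕ) (hm : m ≤ n) : TakeuchiEval (n + 1) (m + 1) 0 (n + 1)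
      (if m = n then 0 else takeuchiCount n (m + 1) +
        if m = 0 then takeuchiCount n n else 0) := by
  rcases hm.eq_or_lt with rfl | hlt
  · rw [if_pos rfl]
    exact TakeuchiEval.base _ _ _ le_rfl
  · rw [if_neg hlt.ne]
    have ha := hD m hlt
    have hb := hU m hm
    have hc : TakeuchiEval (0 - 1) (n + 1) (m + 1) (n + 1) 0 := TakeuchiEval.base _ _ _ (by omega)
    obtain ⟨l, rfl⟩ : ∃ l, n = l + 1 := ⟨n - 1, by omega⟩
    -- The outer call is trivial unless `m = 0`; then it is `t(n, 0, n+1)` itself, the source of the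
    -- extra `T(n,n)`.
    have hv : TakeuchiEval ((l + 1 : ℕ) : ℤ) (if m = 0 then 0 else ((l + 1 : ℕ) : ℤ) + 1)
        (((l + 1 : ℕ) : ℤ) + 1) (((l + 1 : ℕ) : ℤ) + 1)
        (if m = 0 then takeuchiCount (l + 1) (l + 1) else 0) := by
      split_ifs with h0
      · simpa using hU (l + 1) le_rfl
      · exact TakeuchiEval.base _ _ _ (by omega)
    have := TakeuchiEval.step (((l + 1 : ℕ) : ℤ) + 1) (m + 1) 0 _ _ _ _ _ _ _ _ (by omega)
      (by simpa using ha) (by simpa using hb) hc hv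
    convert this using 1
    -- One unfolding of `T(n, m+1)` yields exactly the `1` and the costs of `ha` and `hb`.
    rw [takeuchiCount]
    simp only [Nat.add_right_cancel_iff]
    ring

/-- Evaluating `t(m, 0, n+1)` calls `t(n, m, 0)` and conversely, so both families are treated
together. The values are carried along because they decide whether the outer calls are trivial. -/
theorem takeuchiEval_count (n : ℕ) :
    (∀ m ≤ n, TakeuchiEval m 0 (n + 1) (if m = 0 then 0 else n + 1) (takeuchiCount n m)) ∧
    (∀ m, m + 1 ≤ n → TakeuchiEval n (m + 1) 0 n
      (if m + 1 = n then 0 else takeuchiCount (n - 1) (m + 1) +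
        if m = 0 then takeuchiCount (n - 1) (n - 1) else 0)) := by
  induction n with
  | zero =>
    refine ⟨fun m hm => ?_, fun m hm => by omega⟩
    obtain rfl : m = 0 := by omega
    simpa [takeuchiCount] using TakeuchiEval.base 0 0 (0 + 1) le_rfl
  | succ n ih =>
    have hD := takeuchiEval_desc ih.1 ih.2
    refine ⟨fun m hm => ?_, fun m hm => ?_⟩
    · induction m with
      | zero =>
        rw [takeuchiCount]
        simpa using TakeuchiEval.base 0 0 ((n + 1 : ℕ) + 1) le_rfl
      | succ m ihm =>
        have ha := ihm (by omega)
        have hb : TakeuchiEval (0 - 1) ((n + 1 : ℕ) + 1) ((m + 1 : ℕ)) ((n + 1 : ℕ) + 1) 0 :=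
          TakeuchiEval.base _ _ _ (by omega)
        have hc := hD m (by omega)
        have hv : TakeuchiEval (if m = 0 then 0 else ((n + 1 : ℕ) : ℤ) + 1)
            (((n + 1 : ℕ) : ℤ) + 1) (n + 1) (((n + 1 : ℕ) : ℤ) + 1) 0 :=
          TakeuchiEval.base _ _ _ (by split_ifs <;> omega)
        have := TakeuchiEval.step ((m + 1 : ℕ) : ℤ) 0 ((n + 1 : ℕ) + 1) _ _ _ _ _ _ _ _ (by omega)
          (by simpa using ha) hb (by simpa using hc) hv
        rw [if_neg (by omega), takeuchiCount]
        convert this using 1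
        ring
    · simpa using hD m (by omega)

theorem isTakeuchiNumber_iff (n N : ℕ) : IsTakeuchiNumber n N ↔ N = takeuchiCount n n := by
  have h := (takeuchiEval_count n).1 n le_rfl
  constructor
  · rintro ⟨v, hv⟩
    exact (hv.unique h).2
  · rintro rfl
    exact ⟨_, h⟩

/-! ### Solving the recurrence for the counts. -/

/-- The counts along a diagonal, with the term of lower index in the recurrence for `m = 1`
absorbed into the boundary value. -/
def takeuchiDiagonal (m s : ℕ) : ℤ :=
  if m = 0 then 1 + takeuchiCount s s else 1 + takeuchiCount (m + 1 + s) m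

theorem takeuchiCount_diag (m : ℕ) :
    (takeuchiCount (m + 1) (m + 1) : ℤ) = takeuchiDiagonal m 0 := by
  rw [takeuchiCount, if_pos rfl, takeuchiDiagonal]
  rcases Nat.eq_zero_or_pos m with rfl | h
  · simp [takeuchiCount]
  · rw [if_neg h.ne']
    push_cast
    ring_nf

theorem takeuchiDiagonal_succ (m s : ℕ) : takeuchiDiagonal (m + 1) s =
    takeuchiCount (m + 1 + s) (m + 1) + 1 + takeuchiDiagonal m (s + 1) := by
  rw [takeuchiDiagonal, if_neg (by omega),
    show m + 1 + 1 + s = (m + 1 + s) + 1 by ring, takeuchiCount, if_neg (by omega),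
    takeuchiDiagonal]
  rcases Nat.eq_zero_or_pos m with rfl | h
  · simp only [if_true, zero_add, takeuchiCount_zero]
    push_cast
    ring_nf
  · rw [if_neg h.ne', if_neg h.ne', show m + 1 + (s + 1) = m + 1 + s + 1 by ring]
    push_cast
    ring

theorem catalanPartialSum_succ (n : ℕ) :
    catalanPartialSum (n + 1) = catalanPartialSum n + catalan (n + 1) :=
  Finset.sum_range_succ _ n

/-- Summation by parts trades one unit of `L` for one of `m` and contributes a Catalan number. At `L
= 0` only `takeuchiDiagonal m 0` is left. -/
theorem sum_takeuchiDiagonal (L m : ℕ) :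
    ∑ s ∈ Finset.range (L + 1), takeuchiDiagonal m s * ballot (s + 1) (L - s) +
      catalanPartialSum L = takeuchiCount (m + L + 1) (m + L + 1) := by
  induction L generalizing m with
  | zero => simp [ballot_zero_right, catalanPartialSum, takeuchiCount_diag]
  | succ L ih =>
    have h := sum_mul_ballot_succ (takeuchiDiagonal m) (takeuchiDiagonal (m + 1)) L
      (by rw [takeuchiDiagonal_succ, add_zero, takeuchiCount_diag])
      -- Away from `s = 0`, the count in `takeuchiDiagonal_succ` lies on diagonal `m + 1` itself,
      -- one step earlier, and absorbs the constant `1`.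
      (fun s => by
        have e : takeuchiDiagonal (m + 1) s = 1 + takeuchiCount (m + 1 + (s + 1)) (m + 1) := by
          rw [takeuchiDiagonal, if_neg (by omega), show m + 1 + 1 + s = m + 1 + (s + 1) by ring]
        rw [takeuchiDiagonal_succ m (s + 1), e]
        ring)
    have h' := ih (m + 1)
    rw [← h] at h'
    rw [catalanPartialSum_succ, show m + (L + 1) + 1 = m + 1 + L + 1 by ring, ← h']
    push_cast
    ring

/-- This is the case `m = 0` of `sum_takeuchiDiagonal`: the ones in `1 + T(k,k)` sum to `C_{n+1}` by
`sum_ballot`, which completes the partial sum. -/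
theorem takeuchiCount_succ (n : ℕ) : (takeuchiCount (n + 1) (n + 1) : ℤ) =
    catalanPartialSum (n + 1) +
      ∑ k ∈ Finset.range (n + 1), catalanTriangle n k * takeuchiCount k k := by
  have h := sum_takeuchiDiagonal n 0
  have h1 : ballot 2 n = catalan (n + 1) := by
    rw [← ballot_one, ballot_succ_succ, ballot_zero_left]
    simp
  have h2 := sum_ballot n 0
  rw [zero_add, h1] at h2
  rw [zero_add] at h
  rw [← h, catalanPartialSum_succ]
  push_cast
  rw [← h2, add_assoc, ← Finset.sum_add_distrib, add_comm]
  congr 1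
  refine Finset.sum_congr rfl fun k hk => ?_
  rw [catalanTriangle_apply, if_pos (Nat.lt_succ_iff.1 (Finset.mem_range.1 hk)), takeuchiDiagonal,
    if_pos rfl]
  ring

theorem takeuchiCount_eq_infMulVec (n : ℕ) : (takeuchiCount n n : ℤ) =
    infMulVec catalanEigentriangle (fun k => (catalanPartialSum k : ℤ)) n :=
  eq_infMulVec_catalanEigentriangle (s := fun n => (takeuchiCount n n : ℤ))
    (by simp [takeuchiCount, catalanPartialSum]) takeuchiCount_succ n

theorem takeuchiCount_eq_sum (n : ℕ) : (takeuchiCount n n : ℚ) = ∑ k ∈ Finset.range (n + 1),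
    eTilde (n - k) k * ∑ j ∈ Finset.range k, (catalan (j + 1) : ℚ) := by
  have h := congrArg (Int.cast : ℤ → ℚ) (takeuchiCount_eq_infMulVec n)
  rw [infMulVec_apply isLowerTriangular_catalanEigentriangle] at h
  push_cast at h
  rw [h]
  refine Finset.sum_congr rfl fun k hk => ?_
  rw [catalanEigentriangle_cast, if_pos (Nat.lt_succ_iff.1 (Finset.mem_range.1 hk)),
    catalanPartialSum]
  push_cast
  rfl

theorem mainTheorem6 :
    (∀ n k : ℕ, k ≤ n → (catalanTriangle n k : ℚ) =
      ((2 * n - k).choose (n - k) : ℚ) * (((k + 1 : ℕ) : ℚ) / ((n + 1 : ℕ) : ℚ))) ∧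
    ∃ E : Matrix ℕ ℕ ℤ, ∃ t : ℕ → ℕ,
      (∀ E' : Matrix ℕ ℕ ℤ, IsEigentriangle catalanTriangle E' ↔ E' = E) ∧
      IsTriangularInverse
        (riordanMatrix 1 PowerSeries.X -
          riordanMatrix (PowerSeries.X * catalanGF) (PowerSeries.X * catalanGF)) E ∧
      (∀ n k : ℕ, (E n k : ℚ) = if k ≤ n then eTilde (n - k) k else 0) ∧
      (∀ n N : ℕ, IsTakeuchiNumber n N ↔ N = t n) ∧
      (∀ n : ℕ, (t n : ℤ) = infMulVec E (fun k => (catalanPartialSum k : ℤ)) n) ∧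
      (∀ n : ℕ, (t n : ℚ) = ∑ k ∈ Finset.range (n + 1),
        eTilde (n - k) k * ∑ j ∈ Finset.range k, (catalan (j + 1) : ℚ)) := by
  exact ⟨fun _ _ => catalanTriangle_formula, catalanEigentriangle, fun n => takeuchiCount n n,
    isEigentriangle_iff, isTriangularInverse_catalanEigentriangle, catalanEigentriangle_cast,
    isTakeuchiNumber_iff, takeuchiCount_eq_infMulVec, takeuchiCount_eq_sum⟩
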